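/- Let $N\ge 0$, and call a sequence $\alpha=(\alpha_0,\dots,\alpha_N)$ of complex numbers a system of parameters if $|\alpha_n|<1$ for $0\le n<N$ and $|\alpha_N|=1$. Put $\rho_n=\sqrt{1-|\alpha_n|^2}$ and $\alpha_{-1}=-1$. The $(N+1)\times(N+1)$ CMV matrix $\mathcal C(\alpha)=(c_{ij})_{i,j=0}^{N}$ is the five-diagonal matrix with entries $$c_{mm}=-\overline{\alpha_m}\,\alpha_{m-1},$$ $$c_{m+1,m}=\begin{cases}-\alpha_{m-1}\rho_m,& m\text{ even},\\ \overline{\alpha_{m+1}}\,\rho_m,& m\text{ odd},\end{cases}\qquad c_{m,m+1}=\begin{cases}\overline{\alpha_{m+1}}\,\rho_m,& m\text{ even},\\ -\alpha_{m-1}\rho_m,& m\text{ odd},\end{cases}$$ $$c_{m+2,m}=\begin{cases}0,& m\text{ even},\\ \rho_m\rho_{m+1},& m\text{ odd},\end{cases}\qquad c_{m,m+2}=\begin{cases}\rho_m\rho_{m+1},& m\text{ even},\\ 0,& m\text{ odd},\end{cases}$$ and all other entries equal to $0$. The $N\times N$ truncated CMV matrix $\mathcal T(\alpha)$ is obtained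 from $\mathcal C(\alpha)$ by deleting the first row and the first column. Let $z_1,\dots,z_N$ be (not necessarily distinct) points of the open unit disk. Then there is a system of parameters $\alpha$ such that the eigenvalues of $\mathcal T(\alpha)$, counted with algebraic multiplicity, are exactly $z_1,\dots,z_N$. It is unique up to multiplication by a common unimodular factor: if $\alpha$ is such a system, then a sequence $\beta=(\beta_0,\dots,\beta_N)$ is a system of parameters for which $\mathcal T(\beta)$ has the eigenvalues $z_1,\dots,z_N$, counted with algebraic multiplicity, if and only if there is $c\in\mathbb C$ with $|c|=1$ and $\beta_n=c\,\alpha_n$ for all $n=0,\dots,N$. -/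

import Mathlib

open scoped ComplexConjugate

/-- The number `ρ_n = √(1 - |α_n|²)`. -/
noncomputable def cmvRho (α : ℕ → ℂ) (n : ℕ) : ℂ :=
  ((Real.sqrt (1 - ‖α n‖ ^ 2) : ℝ) : ℂ)

/-- The parameter `α_{n-1}`, with the usual convention `α_{-1} = -1`. -/
def cmvPrev (α : ℕ → ℂ) : ℕ → ℂ
  | 0 => -1
  | n + 1 => α n

/-- The entry in row `i` and column `j` (both counted from `0`) of the five-diagonal CMV matrix
with parameters `α_0, α_1, …`:
```
  conj α₀   conj α₁ * ρ₀    ρ₁ * ρ₀          0              0        …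
  ρ₀       -conj α₁ * α₀   -ρ₁ * α₀          0              0        …
  0         conj α₂ * ρ₁   -conj α₂ * α₁   conj α₃ * ρ₂   ρ₃ * ρ₂    …
  0         ρ₂ * ρ₁        -ρ₂ * α₁       -conj α₃ * α₂  -ρ₃ * α₂    …
  …
``` -/
noncomputable def cmvEntry (α : ℕ → ℂ) (i j : ℕ) : ℂ :=
  if i = j then -(conj (α i)) * cmvPrev α i
  else if i = j + 1 then
    if Odd j then conj (α (j + 1)) * cmvRho α j else -(cmvRho α j) * cmvPrev α j
  else if j = i + 1 then
    if Even i then conj (α (i + 1)) * cmvRho α i else -(cmvRho α i) * cmvPrev α i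
  else if i = j + 2 then
    if Odd j then cmvRho α (j + 1) * cmvRho α j else 0
  else if j = i + 2 then
    if Even i then cmvRho α (i + 1) * cmvRho α i else 0
  else 0

/-- The parameters `α_0, …, α_N` of a finite `(N+1) × (N+1)` (unitary) CMV matrix:
`|α_n| < 1` for `n < N`, and `|α_N| = 1`. Values `α_n` with `n > N` play no role. -/
def IsCMVParameters (N : ℕ) (α : ℕ → ℂ) : Prop :=
  (∀ n < N, ‖α n‖ < 1) ∧ ‖α N‖ = 1

/-- The finite `(N+1) × (N+1)` CMV matrix with parameters `α_0, …, α_N`. -/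
noncomputable def cmvMatrix (N : ℕ) (α : ℕ → ℂ) : Matrix (Fin (N + 1)) (Fin (N + 1)) ℂ :=
  Matrix.of fun i j => cmvEntry α i j

/-- The `N × N` truncated CMV matrix with parameters `α_0, …, α_N`: the CMV matrix with its first
row and first column deleted. -/
noncomputable def truncatedCMV (N : ℕ) (α : ℕ → ℂ) : Matrix (Fin N) (Fin N) ℂ :=
  (cmvMatrix N α).submatrix Fin.succ Fin.succ

/-- The eigenvalues of the square matrix `A`, repeated according to algebraic multiplicity, are
exactly `z_1, …, z_N`, as multisets. -/
def HasEigenvaluesWithMultiplicity {N : ℕ} (A : Matrix (Fin N) (Fin N) ℂ) (z : Fin N → ℂ) : Prop :=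
  A.charpoly.roots = Finset.univ.val.map z

/-! The characteristic polynomial of the truncated CMV matrix is a Szegő polynomial `Φ_N`, with
Verblunsky coefficients `b_j = -conj α_{N-1-j} * α_N` (`charpoly_truncatedCMV_eq_szego`). Running
the Szegő recursion backwards shows that coefficients in the disk correspond bijectively to monic
polynomials with all zeros in the disk (`exists_szego_fst_eq`, `szego_fst_injective`). So the `z_k`
determine exactly the `b_j`, and the `b_j` determine `α` up to a common rotation
(`dualParameters_eq_iff`).

For the characteristic polynomial, factor the matrix as `L * M` with both factors block diagonal and
`M` symmetric unitary. Then `X - L * M = (X * conj M - L) * M`, and the first factor is tridiagonal.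
The three-term recurrence for its lower right minors is the Szegő recursion, with `Φ` and `Φ^*`
exchanging roles at each step (`pencilDet_eq_szego`). -/

open Polynomial

/-! ### Szegő recursion and reversed polynomials -/

/-- The monic Szegő polynomial `Φ_n` with Verblunsky coefficients `b_0, …, b_{n-1}`, together with
its reversed polynomial `Φ_n^*`. -/
noncomputable def szego (b : ℕ → ℂ) : ℕ → ℂ[X] × ℂ[X]
  | 0 => (1, 1)
  | n + 1 => (X * (szego b n).1 - C (conj (b n)) * (szego b n).2,
      (szego b n).2 - C (b n) * (X * (szego b n).1))

/-- The reversed polynomial `z^n * conj (P (1 / conj z))`. -/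
noncomputable def conjReflect (n : ℕ) (P : ℂ[X]) : ℂ[X] :=
  reflect n (P.map (starRingEnd ℂ))

theorem conjReflect_add (n : ℕ) (P Q : ℂ[X]) :
    conjReflect n (P + Q) = conjReflect n P + conjReflect n Q := by
  simp [conjReflect, reflect_add]

theorem conjReflect_sub (n : ℕ) (P Q : ℂ[X]) :
    conjReflect n (P - Q) = conjReflect n P - conjReflect n Q := by
  simp [conjReflect, reflect_sub]

theorem conjReflect_C_mul (n : ℕ) (c : ℂ) (P : ℂ[X]) :
    conjReflect n (C c * P) = C (conj c) * conjReflect n P := by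
  simp [conjReflect, reflect_C_mul]

theorem conjReflect_conjReflect (n : ℕ) (P : ℂ[X]) :
    conjReflect n (conjReflect n P) = P := by
  ext k
  simp [conjReflect, coeff_reflect, coeff_map, revAt_invol]

theorem conjReflect_mul {m n : ℕ} {P Q : ℂ[X]} (hP : P.natDegree ≤ m) (hQ : Q.natDegree ≤ n) :
    conjReflect (m + n) (P * Q) = conjReflect m P * conjReflect n Q := by
  rw [conjReflect, Polynomial.map_mul, reflect_mul _ _ (natDegree_map_le.trans hP)
    (natDegree_map_le.trans hQ)]
  rfl

theorem conjReflect_zero_one : conjReflect 0 1 = 1 := by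
  rw [conjReflect, Polynomial.map_one, ← C_1, reflect_C]
  simp

theorem conjReflect_one_X : conjReflect 1 X = 1 := by
  simp [conjReflect, reflect_one_X]

theorem conjReflect_X_mul {n : ℕ} {P : ℂ[X]} (hP : P.natDegree ≤ n) :
    conjReflect (n + 1) (X * P) = conjReflect n P := by
  rw [add_comm, conjReflect_mul natDegree_X_le hP, conjReflect_one_X, one_mul]

theorem natDegree_conjReflect_le {n : ℕ} {P : ℂ[X]} (hP : P.natDegree ≤ n) :
    (conjReflect n P).natDegree ≤ n := by
  rw [natDegree_le_iff_coeff_eq_zero]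
  intro k hk
  rw [conjReflect, coeff_reflect, revAt_eq_self_of_lt hk, coeff_map,
    coeff_eq_zero_of_natDegree_lt (hP.trans_lt hk), map_zero]

theorem conjReflect_succ {n : ℕ} {P : ℂ[X]} (hP : P.natDegree ≤ n) :
    conjReflect (n + 1) P = X * conjReflect n P := by
  have h := conjReflect_X_mul (natDegree_conjReflect_le hP)
  rw [conjReflect_conjReflect] at h
  rw [← conjReflect_conjReflect (n + 1) (X * conjReflect n P), h]

theorem conjReflect_coeff_zero (n : ℕ) (P : ℂ[X]) :
    (conjReflect n P).coeff 0 = conj (P.coeff n) := by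
  simp [conjReflect, coeff_reflect, coeff_map, revAt_le]

theorem conjReflect_coeff_self (n : ℕ) (P : ℂ[X]) :
    (conjReflect n P).coeff n = conj (P.coeff 0) := by
  simp [conjReflect, coeff_reflect, coeff_map, revAt_le]

/-- Reversal exchanges the two lines of the recursion. The degree bound is carried along because the
reversal rules need it. -/
theorem natDegree_szego_fst_le_and_szego_snd (b : ℕ → ℂ) (n : ℕ) :
    (szego b n).1.natDegree ≤ n ∧ (szego b n).2 = conjReflect n (szego b n).1 := by
  induction n with
  | zero => simp [szego, conjReflect_zero_one]
  | succ n ih =>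
    obtain ⟨hd, hs⟩ := ih
    refine ⟨?_, ?_⟩
    · refine (natDegree_sub_le _ _).trans (max_le ?_ ?_)
      · exact natDegree_mul_le.trans (by rw [natDegree_X]; omega)
      · rw [hs]
        exact (natDegree_C_mul_le _ _).trans ((natDegree_conjReflect_le hd).trans n.le_succ)
    · simp only [szego]
      rw [hs, conjReflect_sub, conjReflect_C_mul, conjReflect_X_mul hd,
        conjReflect_succ (natDegree_conjReflect_le hd), conjReflect_conjReflect]
      simp

theorem szego_snd_coeff_zero (b : ℕ → ℂ) (n : ℕ) : (szego b n).2.coeff 0 = 1 := by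
  induction n with
  | zero => simp [szego]
  | succ n ih => simp [szego, ih]

theorem szego_fst_monic (b : ℕ → ℂ) (n : ℕ) : (szego b n).1.Monic := by
  obtain ⟨hd, hs⟩ := natDegree_szego_fst_le_and_szego_snd b n
  refine monic_of_natDegree_le_of_coeff_eq_one n hd ?_
  have h := szego_snd_coeff_zero b n
  rw [hs, conjReflect_coeff_zero] at h
  simpa using congrArg conj h

theorem szego_congr {b b' : ℕ → ℂ} {n : ℕ} (h : ∀ k < n, b k = b' k) :
    szego b n = szego b' n := by
  induction n with
  | zero => rfl
  | succ n ih =>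
    simp only [szego]
    rw [ih fun k hk => h k (hk.trans n.lt_succ_self), h n n.lt_succ_self]

/-! ### Inverse Szegő recursion: uniqueness -/

theorem one_sub_conj_mul_self_ne_zero {b : ℂ} (hb : ‖b‖ < 1) : 1 - conj b * b ≠ 0 := by
  rw [Complex.conj_mul', sub_ne_zero]
  norm_cast
  have := norm_nonneg b
  nlinarith

/-- The Verblunsky coefficients are determined by the Szegő polynomial. -/
theorem szego_fst_injective {b b' : ℕ → ℂ} {n : ℕ} (hb : ∀ k < n, ‖b k‖ < 1)
    (h : (szego b n).1 = (szego b' n).1) : ∀ k < n, b k = b' k := by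
  induction n with
  | zero => simp
  | succ n ih =>
    have h2 : (szego b (n + 1)).2 = (szego b' (n + 1)).2 := by
      rw [(natDegree_szego_fst_le_and_szego_snd b _).2,
        (natDegree_szego_fst_le_and_szego_snd b' _).2, h]
    have hn : b n = b' n := by
      have h0 := congrArg (fun P : ℂ[X] => P.coeff 0) h
      simp [szego, szego_snd_coeff_zero] at h0
      simpa using congrArg conj h0
    -- Inverse recursion: eliminating `Φ_n^*` recovers `Φ_n` from `Φ_{n+1}` and its reversal.
    have key : ∀ c : ℕ → ℂ, C (1 - conj (c n) * c n) * (X * (szego c n).1) =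
        (szego c (n + 1)).1 + C (conj (c n)) * (szego c (n + 1)).2 := by
      intro c
      simp only [szego, map_sub, map_mul, map_one]
      ring
    have h3 : C (1 - conj (b n) * b n) * (X * (szego b n).1) =
        C (1 - conj (b n) * b n) * (X * (szego b' n).1) := by
      rw [key b, h, h2, hn, key b']
    have hne : C (1 - conj (b n) * b n) ≠ 0 :=
      C_ne_zero.2 (one_sub_conj_mul_self_ne_zero (hb n n.lt_succ_self))
    have h4 := ih (fun k hk => hb k (hk.trans n.lt_succ_self))
      (mul_left_cancel₀ X_ne_zero (mul_left_cancel₀ hne h3))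
    intro k hk
    rcases Nat.lt_succ_iff_lt_or_eq.1 hk with h5 | rfl
    · exact h4 k h5
    · exact hn

/-! ### Inverse Szegő recursion: existence -/

/-- The squares differ by `(|w|² - 1)(1 - |z|²)`. -/
theorem norm_one_sub_conj_mul_le {z w : ℂ} (hz : ‖z‖ < 1) (hw : 1 ≤ ‖w‖) :
    ‖1 - conj z * w‖ ≤ ‖w - z‖ := by
  refine le_of_sq_le_sq ?_ (norm_nonneg _)
  have h1 : ‖z‖ ^ 2 < 1 := by have := norm_nonneg z; nlinarith
  have h2 : 1 ≤ ‖w‖ ^ 2 := by nlinarith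
  rw [← Complex.normSq_eq_norm_sq, Complex.normSq_apply] at h1 h2 ⊢
  rw [← Complex.normSq_eq_norm_sq, Complex.normSq_apply]
  simp only [Complex.sub_re, Complex.sub_im, Complex.mul_re, Complex.mul_im, Complex.conj_re,
    Complex.conj_im, Complex.one_re, Complex.one_im]
  nlinarith [mul_nonneg (sub_nonneg.2 h1.le) (sub_nonneg.2 h2)]

theorem norm_eval_conjReflect_prod_le (s : Multiset ℂ) (hs : ∀ z ∈ s, ‖z‖ < 1) {w : ℂ}
    (hw : 1 ≤ ‖w‖) :
    ‖(conjReflect s.card (s.map fun z => X - C z).prod).eval w‖ ≤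
      ‖((s.map fun z => X - C z).prod).eval w‖ := by
  induction s using Multiset.induction_on with
  | empty => simp [conjReflect_zero_one]
  | cons z s ih =>
    have h1 : conjReflect 1 (X - C z) = 1 - C (conj z) * X := by
      have h := conjReflect_succ (n := 0) (P := C z) (by simp)
      rw [zero_add] at h
      rw [conjReflect_sub, conjReflect_one_X, h]
      rw [← mul_one (C z), conjReflect_C_mul, conjReflect_zero_one, mul_one, mul_comm]
    have h2 : ((s.map fun z => X - C z).prod : ℂ[X]).natDegree ≤ s.card := by
      rw [natDegree_multiset_prod_X_sub_C_eq_card]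
    rw [Multiset.map_cons, Multiset.prod_cons, Multiset.card_cons, add_comm,
      conjReflect_mul (natDegree_X_sub_C_le z) h2, h1, eval_mul, eval_mul, norm_mul, norm_mul]
    refine mul_le_mul ?_ (ih fun z hz => hs z (Multiset.mem_cons_of_mem hz)) (norm_nonneg _)
      (norm_nonneg _)
    simpa using norm_one_sub_conj_mul_le (hs z (Multiset.mem_cons_self z s)) hw

/-- `P^* / P` is a product of factors `(1 - conj z * w) / (w - z)`, each of modulus at most 1 off
the open disk. -/
theorem norm_eval_conjReflect_le {n : ℕ} {P : ℂ[X]} (hP : P.Monic) (hn : P.natDegree = n)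
    (hr : ∀ z, P.IsRoot z → ‖z‖ < 1) {w : ℂ} (hw : 1 ≤ ‖w‖) :
    ‖(conjReflect n P).eval w‖ ≤ ‖P.eval w‖ := by
  have hsplit := IsAlgClosed.splits P
  have h := norm_eval_conjReflect_prod_le P.roots (fun z hz => hr z (isRoot_of_mem_roots hz)) hw
  rwa [← hsplit.natDegree_eq_card_roots, hn,
    ← hsplit.eq_prod_roots_of_monic hP] at h

theorem norm_coeff_zero_lt_one {P : ℂ[X]} (hP : P.Monic) (hn : P.natDegree ≠ 0)
    (hr : ∀ z, P.IsRoot z → ‖z‖ < 1) : ‖P.coeff 0‖ < 1 := by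
  have hsplit := IsAlgClosed.splits P
  have key : ∀ s : Multiset ℂ, (∀ z ∈ s, ‖z‖ < 1) → ‖s.prod‖ ≤ 1 ∧ (s ≠ 0 → ‖s.prod‖ < 1) := by
    intro s
    induction s using Multiset.induction_on with
    | empty => simp
    | cons z s ih =>
      intro hs
      have h1 := hs z (Multiset.mem_cons_self z s)
      have h2 := (ih fun z hz => hs z (Multiset.mem_cons_of_mem hz)).1
      have h3 : ‖(z ::ₘ s).prod‖ < 1 := by
        rw [Multiset.prod_cons, norm_mul]
        exact mul_lt_one_of_nonneg_of_lt_one_left (norm_nonneg _) h1 h2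
      exact ⟨h3.le, fun _ => h3⟩
  rw [hsplit.coeff_zero_eq_prod_roots_of_monic hP, norm_mul, norm_pow, norm_neg, norm_one, one_pow,
    one_mul]
  refine (key P.roots fun z hz => hr z (isRoot_of_mem_roots hz)).2 fun h => hn ?_
  rw [hsplit.natDegree_eq_card_roots, h, Multiset.card_zero]

/-- Every monic polynomial with all zeros in the open unit disk is a Szegő polynomial. -/
theorem exists_szego_fst_eq (n : ℕ) (P : ℂ[X]) (hP : P.Monic) (hn : P.natDegree = n)
    (hr : ∀ z, P.IsRoot z → ‖z‖ < 1) :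
    ∃ b : ℕ → ℂ, (∀ k < n, ‖b k‖ < 1) ∧ (szego b n).1 = P := by
  induction n generalizing P with
  | zero =>
    exact ⟨fun _ => 0, by simp, (hP.natDegree_eq_zero.1 hn).symm⟩
  | succ n ih =>
    have h0 := norm_coeff_zero_lt_one hP (by omega) hr
    -- Forced choice: `Φ_n^*(0) = 1`, so `Φ_{n+1}(0) = -conj b_n`.
    obtain ⟨b, hb⟩ : ∃ b, b = -conj (P.coeff 0) := ⟨_, rfl⟩
    have hb1 : ‖b‖ < 1 := by rwa [hb, norm_neg, RCLike.norm_conj]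
    have hne := one_sub_conj_mul_self_ne_zero hb1
    obtain ⟨Q, hQ⟩ : ∃ Q, Q = conjReflect (n + 1) P := ⟨_, rfl⟩
    have hP1 : P.coeff (n + 1) = 1 := by rw [← hn]; exact hP
    have hQ0 : Q.coeff 0 = 1 := by rw [hQ, conjReflect_coeff_zero, hP1, map_one]
    have hQ1 : Q.coeff (n + 1) = -b := by rw [hQ, conjReflect_coeff_self, hb, neg_neg]
    have hQd : Q.natDegree ≤ n + 1 := hQ ▸ natDegree_conjReflect_le hn.le
    have hP0 : P.coeff 0 = -conj b := by simp [hb]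
    obtain ⟨R, hR⟩ : ∃ R, R = P + C (conj b) * Q := ⟨_, rfl⟩
    have hRX : X * R.divX = R := by
      have h := divX_mul_X_add R
      have h1 : R.coeff 0 = 0 := by simp [hR, hQ0, hP0]
      rw [h1, C_0, add_zero] at h
      rw [mul_comm]
      exact h
    obtain ⟨P', hP'⟩ : ∃ P', P' = C (1 - conj b * b)⁻¹ * R.divX := ⟨_, rfl⟩
    have hXP' : C (1 - conj b * b) * (X * P') = R := by
      rw [hP', mul_left_comm X, ← mul_assoc, ← C_mul, mul_inv_cancel₀ hne, C_1, one_mul, hRX]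
    have hRd : R.natDegree ≤ n + 1 :=
      hR ▸ natDegree_add_le_of_degree_le hn.le ((natDegree_C_mul_le _ _).trans hQd)
    have hd : P'.natDegree ≤ n := by
      rw [hP']
      refine (natDegree_C_mul_le _ _).trans ?_
      rw [natDegree_divX_eq_natDegree_tsub_one]
      omega
    have hc : P'.coeff n = 1 := by
      rw [hP', coeff_C_mul, coeff_divX, hR, coeff_add, coeff_C_mul, hP1, hQ1, mul_neg,
        ← sub_eq_add_neg, inv_mul_cancel₀ hne]
    have hmonic : P'.Monic := monic_of_natDegree_le_of_coeff_eq_one n hd hc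
    -- At a root `w` off the disk, `|P w| = |b| |P^* w| ≤ |b| |P w|` with `|b| < 1`, so `P w = 0`,
    -- which is impossible.
    have hroot : ∀ z, P'.IsRoot z → ‖z‖ < 1 := by
      intro w hw
      by_contra! hw1
      have h1 : R.eval w = 0 := by
        rw [← hXP', eval_mul, eval_mul, hw.eq_zero, mul_zero, mul_zero]
      have h2 := norm_eval_conjReflect_le hP hn hr hw1
      rw [← hQ] at h2
      rw [hR, eval_add, eval_mul, eval_C] at h1
      have h3 : ‖P.eval w‖ = ‖b‖ * ‖Q.eval w‖ := by
        rw [eq_neg_of_add_eq_zero_left h1, norm_neg, norm_mul, RCLike.norm_conj]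
      have h4 : P.eval w = 0 := by
        rw [← norm_eq_zero]
        have := norm_nonneg (P.eval w)
        have := norm_nonneg b
        nlinarith
      exact absurd (hr w h4) (not_lt.2 hw1)
    obtain ⟨c, hc1, hc2⟩ := ih P' hmonic
      (natDegree_eq_of_le_of_coeff_ne_zero hd (by rw [hc]; exact one_ne_zero)) hroot
    -- Reversing the identity for `X * P'` gives the other half of the inverse recursion.
    have hQ' : C (1 - conj b * b) * conjReflect n P' = Q + C b * P := by
      have h := congrArg (conjReflect (n + 1)) hXP'
      rw [conjReflect_C_mul, conjReflect_X_mul hd, hR, conjReflect_add, conjReflect_C_mul, hQ,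
        conjReflect_conjReflect, Complex.conj_conj] at h
      rw [hQ, ← h]
      simp [mul_comm]
    let e : ℕ → ℂ := fun k => if k = n then b else c k
    have hen : e n = b := if_pos rfl
    have hek : ∀ k < n, e k = c k := fun k hk => if_neg hk.ne
    refine ⟨e, fun k hk => ?_, ?_⟩
    · rcases Nat.lt_succ_iff_lt_or_eq.1 hk with h5 | rfl
      · rw [hek k h5]; exact hc1 k h5
      · rwa [hen]
    · have h6 : (szego e n).1 = P' := by rw [szego_congr hek, hc2]
      simp only [szego]
      rw [(natDegree_szego_fst_le_and_szego_snd e n).2, h6, hen]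
      refine mul_left_cancel₀ (C_ne_zero.2 hne) ?_
      rw [mul_sub, hXP', mul_left_comm, hQ', hR]
      simp only [map_sub, map_mul, map_one]
      ring

/-! ### Determinants and products of tridiagonal matrices -/

section Tridiagonal

variable {R : Type*} [CommRing R]

/-- The entries of the symmetric tridiagonal matrix with diagonal `a` and off-diagonal `b`. -/
def tridiagEntry (a b : ℕ → R) (i j : ℕ) : R :=
  if i = j then a i else if j = i + 1 then b i else if i = j + 1 then b j else 0

/-- The symmetric tridiagonal matrix of size `n` with diagonal `a` and off-diagonal `b`. -/
def tridiag (a b : ℕ → R) (n : ℕ) : Matrix (Fin n) (Fin n) R :=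
  Matrix.of fun i j => tridiagEntry a b i j

theorem tridiagEntry_eq_zero (a b : ℕ → R) {i j : ℕ} (h : j + 1 < i ∨ i + 1 < j) :
    tridiagEntry a b i j = 0 := by
  rw [tridiagEntry, if_neg (by omega), if_neg (by omega), if_neg (by omega)]

theorem tridiagEntry_succ (a b : ℕ → R) (i j : ℕ) :
    tridiagEntry a b (i + 1) (j + 1) =
      tridiagEntry (fun k => a (k + 1)) (fun k => b (k + 1)) i j := by
  simp [tridiagEntry]

theorem tridiag_submatrix_succ (a b : ℕ → R) (n : ℕ) :
    (tridiag a b (n + 1)).submatrix Fin.succ Fin.succ =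
      tridiag (fun k => a (k + 1)) (fun k => b (k + 1)) n := by
  ext i j
  simp [tridiag, tridiagEntry_succ]

theorem det_tridiag_succ_succ (a b : ℕ → R) (n : ℕ) :
    (tridiag a b (n + 2)).det =
      a 0 * (tridiag (fun k => a (k + 1)) (fun k => b (k + 1)) (n + 1)).det -
        b 0 ^ 2 * (tridiag (fun k => a (k + 2)) (fun k => b (k + 2)) n).det := by
  rw [Matrix.det_succ_row_zero, Fin.sum_univ_succ, Fin.sum_univ_succ, Finset.sum_eq_zero]
  · have h1 : ((tridiag a b (n + 2)).submatrix Fin.succ (Fin.succAbove (Fin.succ 0))).det =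
        b 0 * (tridiag (fun k => a (k + 2)) (fun k => b (k + 2)) n).det := by
      rw [Matrix.det_succ_column_zero, Fin.sum_univ_succ, Finset.sum_eq_zero]
      · have h2 : ((tridiag a b (n + 2)).submatrix Fin.succ (Fin.succAbove (Fin.succ 0))).submatrix
            (Fin.succAbove 0) Fin.succ = tridiag (fun k => a (k + 2)) (fun k => b (k + 2)) n := by
          ext i j
          simp [tridiag, tridiagEntry_succ, Fin.succAbove, Fin.lt_def]
        rw [h2]
        simp [tridiag, tridiagEntry]
      · intro i _
        simp [tridiag, tridiagEntry]
    rw [h1]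
    have h3 : (tridiag a b (n + 2)).submatrix Fin.succ (Fin.succAbove 0) =
        tridiag (fun k => a (k + 1)) (fun k => b (k + 1)) (n + 1) := by
      rw [← tridiag_submatrix_succ, Fin.succAbove_zero]
    rw [h3]
    simp [tridiag, tridiagEntry]
    ring
  · intro i _
    simp [tridiag, tridiagEntry]

theorem det_tridiag_one (a b : ℕ → R) : (tridiag a b 1).det = a 0 := by
  simp [tridiag, tridiagEntry]

/-- `hb` kills the term `f n` that falls outside the sum in the last row. -/
theorem sum_tridiagEntry_mul {n : ℕ} (a b : ℕ → R) (hb : ∀ i, i + 1 = n → b i = 0)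
    (f : ℕ → R) {i : ℕ} (hi : i < n) :
    ∑ k : Fin n, tridiagEntry a b i k * f k =
      a i * f i + b i * f (i + 1) + (if i = 0 then 0 else b (i - 1) * f (i - 1)) := by
  rw [Fin.sum_univ_eq_sum_range (fun k => tridiagEntry a b i k * f k)]
  have h : ∀ k, tridiagEntry a b i k * f k = (if k = i then a i * f i else 0) +
      (if k = i + 1 then b i * f (i + 1) else 0) +
      (if k + 1 = i then b (i - 1) * f (i - 1) else 0) := by
    intro k
    unfold tridiagEntry
    by_cases h1 : k = i
    · subst h1
      simp
    by_cases h2 : k = i + 1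
    · subst h2
      simp [show ¬ i + 1 + 1 = i by omega]
    by_cases h3 : k + 1 = i
    · subst h3
      simp [show ¬ k = k + 1 + 1 by omega]
    rw [if_neg (Ne.symm h1), if_neg h2, if_neg (Ne.symm h3), if_neg h1, if_neg h2, if_neg h3]
    simp
  simp only [h, Finset.sum_add_distrib]
  rw [Finset.sum_ite_eq' (Finset.range n) i, Finset.sum_ite_eq' (Finset.range n) (i + 1),
    if_pos (Finset.mem_range.2 hi)]
  congr 1
  · congr 1
    split_ifs with h1
    · rfl
    · rw [hb i (by simp at h1; omega), zero_mul]
  · rcases i with _ | i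
    · simp
    · simp only [Nat.add_right_cancel_iff, Nat.add_sub_cancel]
      rw [Finset.sum_ite_eq' (Finset.range n) i, if_pos (Finset.mem_range.2 (by omega))]
      simp

theorem tridiag_mul_apply {n : ℕ} (a b a' b' : ℕ → R) (hb : ∀ i, i + 1 = n → b i = 0)
    (i j : Fin n) :
    (tridiag a b n * tridiag a' b' n) i j =
      a i * tridiagEntry a' b' i j + b i * tridiagEntry a' b' (i + 1) j +
        (if (i : ℕ) = 0 then 0 else b (i - 1) * tridiagEntry a' b' (i - 1) j) :=
  sum_tridiagEntry_mul a b hb (fun k => tridiagEntry a' b' k j) i.2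

end Tridiagonal

/-! ### Factorisation of the truncated CMV matrix -/

/-- Diagonal of the block-diagonal factor `-α_0 ⊕ Θ_2 ⊕ Θ_4 ⊕ …`, where
`Θ_k = [[conj α_k, ρ_k], [ρ_k, -α_k]]`. -/
noncomputable def leftDiag (α : ℕ → ℂ) (i : ℕ) : ℂ :=
  if Even i then -α i else conj (α (i + 1))

/-- Off-diagonal of the block-diagonal factor `-α_0 ⊕ Θ_2 ⊕ Θ_4 ⊕ …`. -/
noncomputable def leftOff (α : ℕ → ℂ) (i : ℕ) : ℂ :=
  if Even i then 0 else cmvRho α (i + 1)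

/-- Diagonal of the block-diagonal factor `Θ_1 ⊕ Θ_3 ⊕ …`. -/
noncomputable def rightDiag (α : ℕ → ℂ) (i : ℕ) : ℂ :=
  if Even i then conj (α (i + 1)) else -α i

/-- Off-diagonal of the block-diagonal factor `Θ_1 ⊕ Θ_3 ⊕ …`. -/
noncomputable def rightOff (α : ℕ → ℂ) (i : ℕ) : ℂ :=
  if Even i then cmvRho α (i + 1) else 0

theorem cmvRho_sq {α : ℕ → ℂ} {n : ℕ} (h : ‖α n‖ ≤ 1) :
    cmvRho α n ^ 2 = 1 - conj (α n) * α n := by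
  have h1 : 0 ≤ 1 - ‖α n‖ ^ 2 := by have := norm_nonneg (α n); nlinarith
  rw [cmvRho, ← Complex.ofReal_pow, Real.sq_sqrt h1, Complex.conj_mul']
  push_cast
  rfl

theorem IsCMVParameters.norm_le_one {N : ℕ} {α : ℕ → ℂ} (h : IsCMVParameters N α) {n : ℕ}
    (hn : n ≤ N) : ‖α n‖ ≤ 1 := by
  rcases hn.lt_or_eq with h1 | rfl
  · exact (h.1 n h1).le
  · exact h.2.le

theorem IsCMVParameters.cmvRho_eq_zero {N : ℕ} {α : ℕ → ℂ} (h : IsCMVParameters N α) :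
    cmvRho α N = 0 := by
  simp [cmvRho, h.2]

/-- A truncated CMV matrix is a product of two block-diagonal matrices. -/
theorem truncatedCMV_eq_mul {N : ℕ} {α : ℕ → ℂ} (h : IsCMVParameters N α) :
    truncatedCMV N α =
      tridiag (leftDiag α) (leftOff α) N * tridiag (rightDiag α) (rightOff α) N := by
  ext ⟨i, hi⟩ ⟨j, hj⟩
  rw [tridiag_mul_apply]
  · simp only [truncatedCMV, cmvMatrix, Matrix.submatrix_apply, Matrix.of_apply, Fin.succ_mk]
    by_cases hfar : j + 2 < i ∨ i + 2 < j
    · rw [cmvEntry, if_neg (by omega), if_neg (by omega), if_neg (by omega), if_neg (by omega),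
        if_neg (by omega), tridiagEntry_eq_zero _ _ (by omega), tridiagEntry_eq_zero _ _ (by omega)]
      split_ifs
      · simp
      · rw [tridiagEntry_eq_zero _ _ (by omega)]
        simp
    have hj' : j + 2 = i ∨ j + 1 = i ∨ j = i ∨ j = i + 1 ∨ j = i + 2 := by omega
    clear hfar
    unfold leftDiag leftOff rightDiag rightOff tridiagEntry cmvEntry
    rcases hj' with rfl | rfl | rfl | rfl | rfl
    · rcases Nat.mod_two_eq_zero_or_one j with hp | hp <;>
        simp [Nat.even_iff, Nat.odd_iff, Nat.add_mod, hp] <;>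
        (try split_ifs) <;> first | omega | ring
    · rcases Nat.mod_two_eq_zero_or_one j with hp | hp <;>
        simp [Nat.even_iff, Nat.odd_iff, Nat.add_mod, hp, cmvPrev] <;>
        (try split_ifs) <;> first | omega | ring
    · rcases j with _ | j
      · simp [cmvPrev, mul_comm]
      · by_cases hp : Even j <;> simp [hp, Nat.even_add_one, cmvPrev, mul_comm]
    · rcases i with _ | i
      · simp [cmvPrev, mul_comm]
      · rcases Nat.mod_two_eq_zero_or_one i with hp | hp <;>
          simp [Nat.even_iff, Nat.add_mod, hp, cmvPrev] <;>
          (try split_ifs) <;> first | omega | ring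
    · rcases i with _ | i
      · simp [mul_comm]
      · rcases Nat.mod_two_eq_zero_or_one i with hp | hp <;>
          simp [Nat.even_iff, Nat.add_mod, hp] <;>
          (try split_ifs) <;> first | omega | ring
  -- The only entry that could leave the matrix is `ρ_N`, which vanishes as `|α_N| = 1`.
  · rintro i rfl
    simp [leftOff, h.cmvRho_eq_zero]

/-- Each `Θ_k` is symmetric and unitary, so its entrywise conjugate is its inverse. If the last
block is cut to size one, it is the unimodular number `conj α_N`. -/
theorem tridiag_conj_mul_self {N : ℕ} {α : ℕ → ℂ} (h : IsCMVParameters N α) :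
    tridiag (fun i => conj (rightDiag α i)) (rightOff α) N *
      tridiag (rightDiag α) (rightOff α) N = 1 := by
  ext ⟨i, hi⟩ ⟨j, hj⟩
  rw [tridiag_mul_apply]
  · simp only [Matrix.one_apply, Fin.mk.injEq]
    have hs : cmvRho α (i + 1) ^ 2 = _ := cmvRho_sq (h.norm_le_one hi)
    have hs' : cmvRho α i ^ 2 = _ := cmvRho_sq (h.norm_le_one hi.le)
    by_cases hfar : j + 2 < i ∨ i + 2 < j
    · rw [if_neg (show ¬ i = j by omega), tridiagEntry_eq_zero _ _ (by omega),
        tridiagEntry_eq_zero _ _ (by omega)]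
      split_ifs
      · simp
      · rw [tridiagEntry_eq_zero _ _ (by omega)]
        simp
    have hj' : j + 2 = i ∨ j + 1 = i ∨ j = i ∨ j = i + 1 ∨ j = i + 2 := by omega
    clear hfar
    unfold rightDiag rightOff tridiagEntry
    rcases hj' with rfl | rfl | rfl | rfl | rfl
    · rcases Nat.mod_two_eq_zero_or_one j with hp | hp <;>
        simp [Nat.even_iff, Nat.add_mod, hp] <;>
        (try split_ifs) <;> first | omega | ring
    · rcases Nat.mod_two_eq_zero_or_one j with hp | hp <;>
        simp [Nat.even_iff, Nat.add_mod, hp] <;>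
        (try split_ifs) <;> first | omega | ring
    · rcases j with _ | j
      · simp only [zero_add] at hs
        simp
        linear_combination hs
      · by_cases hp : Even j
        · simp [hp, Nat.even_add_one]
          linear_combination hs'
        · simp [hp, Nat.even_add_one]
          linear_combination hs
    · rcases i with _ | i
      · simp
        ring
      · rcases Nat.mod_two_eq_zero_or_one i with hp | hp <;>
          simp [Nat.even_iff, Nat.add_mod, hp] <;>
          (try split_ifs) <;> first | omega | ring
    · rcases i with _ | i
      · simp
      · rcases Nat.mod_two_eq_zero_or_one i with hp | hp <;>
          simp [Nat.even_iff, Nat.add_mod, hp] <;>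
          omega
  · rintro i rfl
    simp [rightOff, h.cmvRho_eq_zero]

/-! ### Characteristic polynomial through a tridiagonal pencil -/

/-- The diagonal of the pencil `X * Mᴴ - L`. -/
noncomputable def pencilDiag (α : ℕ → ℂ) (i : ℕ) : ℂ[X] :=
  X * C (conj (rightDiag α i)) - C (leftDiag α i)

/-- The off-diagonal of the pencil `X * Mᴴ - L`. -/
noncomputable def pencilOff (α : ℕ → ℂ) (i : ℕ) : ℂ[X] :=
  X * C (rightOff α i) - C (leftOff α i)

theorem charpoly_truncatedCMV {N : ℕ} {α : ℕ → ℂ} (h : IsCMVParameters N α) :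
    (truncatedCMV N α).charpoly = (tridiag (pencilDiag α) (pencilOff α) N).det *
      C (tridiag (rightDiag α) (rightOff α) N).det := by
  have h1 : (truncatedCMV N α).charmatrix = tridiag (pencilDiag α) (pencilOff α) N *
      (tridiag (rightDiag α) (rightOff α) N).map C := by
    have h2 : tridiag (pencilDiag α) (pencilOff α) N =
        (X : ℂ[X]) • (tridiag (fun i => conj (rightDiag α i)) (rightOff α) N).map C -
          (tridiag (leftDiag α) (leftOff α) N).map C := by
      ext1 i j
      simp only [tridiag, tridiagEntry, pencilDiag, pencilOff, Matrix.sub_apply, Matrix.smul_apply,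
        Matrix.map_apply, Matrix.of_apply, smul_eq_mul]
      split_ifs <;> simp
    rw [h2, sub_mul, smul_mul_assoc, ← Matrix.map_mul, ← Matrix.map_mul,
      tridiag_conj_mul_self h, ← truncatedCMV_eq_mul h, Matrix.charmatrix]
    ext1 i j
    simp [Matrix.scalar_apply, Matrix.diagonal, Matrix.one_apply]
  rw [Matrix.charpoly, h1, Matrix.det_mul]
  congr 1
  exact (RingHom.map_det C _).symm

/-- The Verblunsky coefficients of the characteristic polynomial of a truncated CMV matrix. -/
noncomputable def dualParameters (N : ℕ) (α : ℕ → ℂ) (j : ℕ) : ℂ :=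
  -conj (α (N - 1 - j)) * α N

/-- The determinant of the lower right block of the pencil that starts at index `k`. -/
noncomputable def pencilDet (α : ℕ → ℂ) (n k : ℕ) : ℂ[X] :=
  (tridiag (fun i => pencilDiag α (i + k)) (fun i => pencilOff α (i + k)) n).det

theorem pencilDet_zero (α : ℕ → ℂ) (k : ℕ) : pencilDet α 0 k = 1 := Matrix.det_fin_zero

theorem pencilDet_one (α : ℕ → ℂ) (k : ℕ) : pencilDet α 1 k = pencilDiag α k := by
  rw [pencilDet, det_tridiag_one, zero_add]

theorem pencilDet_succ_succ (α : ℕ → ℂ) (n k : ℕ) :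
    pencilDet α (n + 2) k = pencilDiag α k * pencilDet α (n + 1) (k + 1) -
      pencilOff α k ^ 2 * pencilDet α n (k + 2) := by
  rw [pencilDet, det_tridiag_succ_succ]
  simp only [pencilDet, zero_add, add_assoc, add_comm 1, add_comm 2]

/-- Blocks grow from the lower right corner, so the last `α` enters first; hence the reversed
indices in `dualParameters`. The off-diagonal alternates between `X * ρ` (from `M`) and `-ρ` (from
`L`), hence the parity split. The constant `u` may stay unspecified, since monicity fixes it later.
-/
theorem pencilDet_eq_szego {N : ℕ} {α : ℕ → ℂ} (h : IsCMVParameters N α) (n k : ℕ)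
    (hk : n + 1 + k = N) : ∃ u : ℂ,
      if Even k then
        pencilDet α (n + 1) k = C (u * α N) * (szego (dualParameters N α) (n + 1)).1 ∧
        pencilDet α n (k + 1) = C u * (szego (dualParameters N α) n).2
      else
        pencilDet α (n + 1) k = -C (u * conj (α N)) * (szego (dualParameters N α) (n + 1)).2 ∧
        pencilDet α n (k + 1) = C u * (szego (dualParameters N α) n).1 := by
  have hN : C (conj (α N)) * C (α N) = 1 := by
    rw [← C_mul, Complex.conj_mul', h.2]; simp
  induction n generalizing k with
  | zero =>
    refine ⟨1, ?_⟩
    have h1 : dualParameters N α 0 = -conj (α k) * α (k + 1) := by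
      rw [dualParameters]; congr 3 <;> (try congr 1) <;> omega
    have h2 : N = k + 1 := by omega
    subst h2
    split_ifs with hp
    · simp only [zero_add, pencilDet_one, pencilDet_zero, szego, h1, pencilDiag, rightDiag,
        leftDiag, hp, if_true]
      refine ⟨?_, by simp⟩
      simp only [map_neg, map_mul, Complex.conj_conj, map_one]
      linear_combination (-C (α k)) * hN
    · simp only [zero_add, pencilDet_one, pencilDet_zero, szego, h1, pencilDiag, rightDiag,
        leftDiag, hp, if_false]
      refine ⟨?_, by simp⟩
      simp only [map_neg, map_mul, map_one]
      linear_combination X * C (conj (α k)) * hN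
  | succ n ih =>
    obtain ⟨u, hu⟩ := ih (k + 1) (by omega)
    have h1 : dualParameters N α (n + 1) = -conj (α k) * α N := by
      rw [dualParameters]; congr 3; congr 1; omega
    have h2 : dualParameters N α n = -conj (α (k + 1)) * α N := by
      rw [dualParameters]; congr 3; congr 1; omega
    have hs : C (cmvRho α (k + 1)) ^ 2 = 1 - C (conj (α (k + 1))) * C (α (k + 1)) := by
      rw [← C_pow, cmvRho_sq (h.norm_le_one (by omega))]; simp
    rw [pencilDet_succ_succ]
    by_cases hp : Even k
    · rw [if_neg (by simpa [Nat.even_add_one] using hp)] at hu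
      -- Read off from `hu.1`, which is the new second claim.
      refine ⟨-(u * conj (α N)), ?_⟩
      rw [if_pos hp, hu.1, hu.2]
      refine ⟨?_, by simp⟩
      simp only [szego, h1, h2, pencilDiag, pencilOff, rightDiag, leftDiag, rightOff, leftOff, hp,
        if_true, map_neg, map_mul, Complex.conj_conj, map_zero, sub_zero, mul_pow, hs]
      generalize (szego (dualParameters N α) n).1 = P
      generalize (szego (dualParameters N α) n).2 = Q
      linear_combination (C u * C (conj (α N)) * X * C (α (k + 1)) * Q -
        C u * X ^ 2 * C (α (k + 1)) * C (conj (α (k + 1))) * P + C u * X ^ 2 * P +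
        C u * C (conj (α N)) * C (α k) * (Q + C (conj (α (k + 1))) * C (α N) * X * P)) * hN
    · rw [if_pos (by simpa [Nat.even_add_one] using hp)] at hu
      refine ⟨u * α N, ?_⟩
      rw [if_neg hp, hu.1, hu.2]
      refine ⟨?_, by simp⟩
      simp only [szego, h1, h2, pencilDiag, pencilOff, rightDiag, leftDiag, rightOff, leftOff, hp,
        if_false, map_neg, map_mul, Complex.conj_conj, map_zero, zero_sub, mul_zero, neg_sq, hs]
      generalize (szego (dualParameters N α) n).1 = P
      generalize (szego (dualParameters N α) n).2 = Q
      linear_combination (C u * C (α N) * C (conj (α k)) * X *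
        (X * P + C (α (k + 1)) * C (conj (α N)) * Q) +
        C u * C (conj (α (k + 1))) * C (α N) * X * P -
        C u * C (conj (α (k + 1))) * C (α (k + 1)) * Q + C u * Q) * hN

theorem charpoly_truncatedCMV_eq_szego {N : ℕ} {α : ℕ → ℂ} (h : IsCMVParameters N α) :
    (truncatedCMV N α).charpoly = (szego (dualParameters N α) N).1 := by
  rcases N with _ | n
  · simp [Matrix.charpoly, szego]
  · obtain ⟨u, hu⟩ := pencilDet_eq_szego h n 0 rfl
    rw [if_pos Even.zero] at hu
    have h1 := charpoly_truncatedCMV h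
    have h2 : (tridiag (pencilDiag α) (pencilOff α) (n + 1)).det = pencilDet α (n + 1) 0 := rfl
    rw [h2, hu.1, mul_right_comm, ← C_mul] at h1
    -- Both sides are monic up to the unknown constant, so it equals 1.
    have h3 := congrArg leadingCoeff h1
    rw [leadingCoeff_mul, leadingCoeff_C, (Matrix.charpoly_monic _).leadingCoeff,
      (szego_fst_monic _ _).leadingCoeff, mul_one] at h3
    rw [h1, ← h3, C_1, one_mul]

/-! ### Eigenvalues, rotations and the conclusion -/

theorem hasEigenvaluesWithMultiplicity_iff {N : ℕ} (A : Matrix (Fin N) (Fin N) ℂ)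
    (z : Fin N → ℂ) :
    HasEigenvaluesWithMultiplicity A z ↔ A.charpoly = ∏ k, (X - C (z k)) := by
  constructor
  · intro h
    rw [(IsAlgClosed.splits A.charpoly).eq_prod_roots_of_monic A.charpoly_monic,
      show A.charpoly.roots = _ from h, Multiset.map_map]
    rfl
  · intro h
    rw [HasEigenvaluesWithMultiplicity, h]
    exact roots_multiset_prod_X_sub_C (Finset.univ.val.map z) ▸ by
      rw [Multiset.map_map]; rfl

theorem dualParameters_eq_iff {N : ℕ} {α β : ℕ → ℂ} (hα : ‖α N‖ = 1) (hβ : ‖β N‖ = 1) :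
    (∀ k < N, dualParameters N α k = dualParameters N β k) ↔
      ∃ c : ℂ, ‖c‖ = 1 ∧ ∀ n ≤ N, β n = c * α n := by
  have hα' : conj (α N) * α N = 1 := by rw [Complex.conj_mul', hα]; simp
  have hβ' : conj (β N) * β N = 1 := by rw [Complex.conj_mul', hβ]; simp
  constructor
  · intro h
    -- The case `n = N` forces this `c`.
    refine ⟨β N * conj (α N), by simp [hα, hβ], fun n hn => ?_⟩
    rcases hn.lt_or_eq with h1 | rfl
    · have h2 := h (N - 1 - n) (by omega)
      simp only [dualParameters, show N - 1 - (N - 1 - n) = n by omega] at h2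
      have h3 := congrArg conj h2
      simp only [map_mul, map_neg, Complex.conj_conj] at h3
      linear_combination β N * h3 - β n * hβ'
    · rw [mul_assoc, hα', mul_one]
  · rintro ⟨c, hc, h⟩ k hk
    have hc' : conj c * c = 1 := by rw [Complex.conj_mul', hc]; simp
    rw [dualParameters, dualParameters, h N le_rfl, h (N - 1 - k) (by omega), map_mul]
    linear_combination conj (α (N - 1 - k)) * α N * hc'

theorem norm_dualParameters_lt_one {N : ℕ} {α : ℕ → ℂ} (h : IsCMVParameters N α) {k : ℕ}
    (hk : k < N) : ‖dualParameters N α k‖ < 1 := by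
  rw [dualParameters, norm_mul, norm_neg, RCLike.norm_conj, h.2, mul_one]
  exact h.1 _ (by omega)

theorem theorem7p1 (N : ℕ) (z : Fin N → ℂ) (hz : ∀ k, ‖z k‖ < 1) :
    (∃ α : ℕ → ℂ, IsCMVParameters N α ∧
      HasEigenvaluesWithMultiplicity (truncatedCMV N α) z) ∧
    (∀ α : ℕ → ℂ, IsCMVParameters N α →
      HasEigenvaluesWithMultiplicity (truncatedCMV N α) z →
      ∀ β : ℕ → ℂ,
        (IsCMVParameters N β ∧ HasEigenvaluesWithMultiplicity (truncatedCMV N β) z) ↔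
          ∃ c : ℂ, ‖c‖ = 1 ∧ ∀ n ≤ N, β n = c * α n) := by
  refine ⟨?_, fun α hα hαz β => ⟨?_, ?_⟩⟩
  · obtain ⟨b, hb, hbz⟩ := exists_szego_fst_eq N (∏ k, (X - C (z k)))
      (monic_prod_of_monic _ _ fun k _ => monic_X_sub_C _) (by simp) (by
        intro w hw
        rw [IsRoot.def, eval_prod, Finset.prod_eq_zero_iff] at hw
        obtain ⟨k, -, hk⟩ := hw
        rw [eval_sub, eval_X, eval_C, sub_eq_zero] at hk
        exact hk ▸ hz k)
    -- Normalise `α_N = 1`; then `b_j = -conj α_{N-1-j}` is inverted by the same formula.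
    let α : ℕ → ℂ := fun n => if n < N then -conj (b (N - 1 - n)) else 1
    have hαN : α N = 1 := if_neg (lt_irrefl N)
    have hαn : ∀ n < N, α n = -conj (b (N - 1 - n)) := fun n hn => if_pos hn
    have hα : IsCMVParameters N α := by
      refine ⟨fun n hn => ?_, by rw [hαN, norm_one]⟩
      rw [hαn n hn, norm_neg, RCLike.norm_conj]
      exact hb _ (by omega)
    refine ⟨α, hα, ?_⟩
    rw [hasEigenvaluesWithMultiplicity_iff, charpoly_truncatedCMV_eq_szego hα, ← hbz]
    congr 1
    refine szego_congr fun k hk => ?_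
    rw [dualParameters, hαN, hαn _ (by omega), show N - 1 - (N - 1 - k) = k by omega]
    simp
  · rintro ⟨hβ, hβz⟩
    rw [hasEigenvaluesWithMultiplicity_iff, charpoly_truncatedCMV_eq_szego hα] at hαz
    rw [hasEigenvaluesWithMultiplicity_iff, charpoly_truncatedCMV_eq_szego hβ] at hβz
    exact (dualParameters_eq_iff hα.2 hβ.2).1 (szego_fst_injective
      (fun k hk => norm_dualParameters_lt_one hα hk) (hαz.trans hβz.symm))
  · rintro ⟨c, hc, h⟩
    have hβ : IsCMVParameters N β := by
      refine ⟨fun n hn => ?_, ?_⟩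
      · rw [h n hn.le, norm_mul, hc, one_mul]; exact hα.1 n hn
      · rw [h N le_rfl, norm_mul, hc, one_mul]; exact hα.2
    refine ⟨hβ, ?_⟩
    rw [hasEigenvaluesWithMultiplicity_iff, charpoly_truncatedCMV_eq_szego hα] at hαz
    rw [hasEigenvaluesWithMultiplicity_iff, charpoly_truncatedCMV_eq_szego hβ,
      ← szego_congr ((dualParameters_eq_iff hα.2 hβ.2).2 ⟨c, hc, h⟩), hαz]
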